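/- Theorem 3.7. Let $\mathcal H$ be a separable complex Hilbert space and let $A$ be a bounded self-adjoint non-negative operator on $\mathcal H$ with $\ker A=\{0\}$ and $\operatorname{ran}A\neq\mathcal H$. Then: 1. There is a set of closed subspaces $\mathfrak M\subset\mathcal H$, of the cardinality of the continuum, each of which satisfies $$\mathfrak M\cap\operatorname{ran}A^{1/2}=\mathfrak M^\perp\cap\operatorname{ran}A^{1/2}=\{0\}.$$ 2. There is a bounded self-adjoint non-negative operator $B$ on $\mathcal H$ with $\ker B=\{0\}$ and $\operatorname{ran}B^{1/2}\cap\operatorname{ran}A^{1/2}=\{0\}$. 3. Let $B$ be any operator as in 2. For every $x>0$ there is exactly one orthogonal projection $P(x)$ in $\mathcal H$ with $$A=(A+xB)^{1/2}P(x)(A+xB)^{1/2},$$ and it also satisfies $xB=(A+xB)^{1/2}(I-P(x))(A+xB)^{1/2}$. For every $x>0$ the closed subspace $\mathfrak M_x=\operatorname{ran}P(x)$ satisfies $\mathfrak M_x\cap\operatorname{ran}A^{1/2}=\mathfrak M_x^\perp\cap\operatorname{ran}A^{1/2}=\{0\}$; the subspaces $\mathfrak M_x$, $x>0$, are pairwise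 distinct; and $x\mapsto P(x)$ is strongly continuous on $(0,\infty)$, that is, $x\mapsto P(x)h$ is norm continuous on $(0,\infty)$ for each $h\in\mathcal H$. -/

import Mathlib

open scoped Cardinal

noncomputable section

/-- Bounded, self-adjoint, non-negative operators with trivial kernel. -/
def IsNonsingularPositive {H : Type*} [NormedAddCommGroup H] [InnerProductSpace ℂ H]
    (T : H →L[ℂ] H) : Prop :=
  T.IsPositive ∧ ∀ f : H, T f = 0 → f = 0

/-- The linear manifold `ran T^{1/2}`, where `T^{1/2}` is the non-negative square root of a
non-negative bounded operator `T`. -/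
def ranSqrt {H : Type*} [NormedAddCommGroup H] [InnerProductSpace ℂ H] [CompleteSpace H]
    (T : H →L[ℂ] H) : Submodule ℂ H :=
  (CFC.sqrt T).range

/-- `M ∩ ran A^{1/2} = M^⊥ ∩ ran A^{1/2} = {0}`. -/
def HasTrivialIntersections {H : Type*} [NormedAddCommGroup H] [InnerProductSpace ℂ H]
    [CompleteSpace H] (A : H →L[ℂ] H) (M : Submodule ℂ H) : Prop :=
  M ⊓ ranSqrt A = ⊥ ∧ Mᗮ ⊓ ranSqrt A = ⊥

/-- `P` is an orthogonal projection with `A = (A + xB)^{1/2} P (A + xB)^{1/2}`. -/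
def IsLifting {H : Type*} [NormedAddCommGroup H] [InnerProductSpace ℂ H] [CompleteSpace H]
    (A B : H →L[ℂ] H) (x : ℝ) (P : H →L[ℂ] H) : Prop :=
  IsStarProjection P ∧
    A = CFC.sqrt (A + (x : ℂ) • B) * P * CFC.sqrt (A + (x : ℂ) • B)

end

/-! Write `S = A + xB`. Douglas factorization gives `A = S^{1/2} P S^{1/2}` and `xB = S^{1/2} Q
S^{1/2}` with `P, Q ≥ 0` and `P + Q = 1`. The operator `S^{1/2} P Q` maps into both square root
ranges, so disjointness forces `PQ = 0`, which makes `P` a projection. Injectivity of `A` and `B`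
then gives the trivial intersections (`hasTrivialIntersections_range`).

If `P(x) = P(y)` with `x ≠ y`, comparing corners shows that `P` commutes with `S^{1/2}`
(`commute_of_mul_proj_mul_eq`). Hence `ran A ⊆ ran P`, which contradicts the trivial intersection.
Continuity follows because weak limits of projections to a projection are strong.

An admissible `B` comes from Baire category. The manifold `ran A^{1/2}` is a countable union of
closed sets and has infinite codimension, so a generic sequence in `H` is dense while its nonzero
damped combinations avoid `ran A^{1/2}` (`exists_seq_tsum_notMem`). With `T` the synthesis operator
of that sequence, `B = T T†` works. The family `ran P(x)` for this `B` is the required continuum. -/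

open scoped InnerProductSpace

/-! ### Square roots, Douglas factorization and the projection attached to a sum. -/

section OperatorRanges

variable {H K E : Type*} [NormedAddCommGroup H] [InnerProductSpace ℂ H] [CompleteSpace H]
  [NormedAddCommGroup K] [InnerProductSpace ℂ K] [CompleteSpace K]
  [NormedAddCommGroup E] [InnerProductSpace ℂ E] [CompleteSpace E]

omit [CompleteSpace H] [CompleteSpace K] in
/-- A form of Douglas' lemma: an operator dominated by one with dense range factors
through it. -/
theorem exists_comp_eq_of_norm_le (R : H →L[ℂ] K) (L : H →L[ℂ] E) (hR : DenseRange R) (C : ℝ)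
    (h : ∀ z, ‖L z‖ ≤ C * ‖R z‖) : ∃ D : K →L[ℂ] E, ∀ z, D (R z) = L z :=
  ⟨(L : H →ₗ[ℂ] E).extendOfNorm (R : H →ₗ[ℂ] K),
    fun z => LinearMap.extendOfNorm_eq (f := (L : H →ₗ[ℂ] E)) (e := (R : H →ₗ[ℂ] K)) hR ⟨C, h⟩ z⟩

theorem denseRange_adjoint_of_injective (R : H →L[ℂ] K) (hR : ∀ z, R z = 0 → z = 0) :
    DenseRange (ContinuousLinearMap.adjoint R) := by
  have h : R.ker = ⊥ := LinearMap.ker_eq_bot'.2 hR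
  have h1 : ((ContinuousLinearMap.adjoint R).range).topologicalClosure = ⊤ := by
    rw [← Submodule.orthogonal_orthogonal_eq_closure, ContinuousLinearMap.orthogonal_range,
      ContinuousLinearMap.adjoint_adjoint, h, Submodule.bot_orthogonal_eq_top]
  have h2 := (Submodule.dense_iff_topologicalClosure_eq_top).2 h1
  exact h2

theorem sqrt_mul_self_of_isPositive {T : H →L[ℂ] H} (hT : T.IsPositive) :
    CFC.sqrt T * CFC.sqrt T = T :=
  CFC.sqrt_mul_sqrt_self T ((ContinuousLinearMap.nonneg_iff_isPositive T).2 hT)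

theorem sqrt_isPositive (T : H →L[ℂ] H) : (CFC.sqrt T).IsPositive :=
  (ContinuousLinearMap.nonneg_iff_isPositive _).1 (CFC.sqrt_nonneg T)

theorem adjoint_sqrt (T : H →L[ℂ] H) : ContinuousLinearMap.adjoint (CFC.sqrt T) = CFC.sqrt T :=
  (sqrt_isPositive T).isSelfAdjoint.adjoint_eq

theorem inner_sqrt_left (T : H →L[ℂ] H) (f g : H) :
    ⟪CFC.sqrt T f, g⟫_ℂ = ⟪f, CFC.sqrt T g⟫_ℂ := by
  conv_lhs => rw [← adjoint_sqrt T]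
  exact ContinuousLinearMap.adjoint_inner_left _ _ _

theorem sqrt_sqrt_apply {T : H →L[ℂ] H} (hT : T.IsPositive) (f : H) :
    CFC.sqrt T (CFC.sqrt T f) = T f :=
  congrArg (fun S : H →L[ℂ] H => S f) (sqrt_mul_self_of_isPositive hT)

theorem norm_sqrt_apply_sq {T : H →L[ℂ] H} (hT : T.IsPositive) (f : H) :
    ‖CFC.sqrt T f‖ ^ 2 = RCLike.re ⟪T f, f⟫_ℂ := by
  rw [← inner_self_eq_norm_sq (𝕜 := ℂ), inner_sqrt_left, sqrt_sqrt_apply hT]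
  exact inner_re_symm _ _

namespace IsNonsingularPositive

variable {T : H →L[ℂ] H}

theorem sqrt_apply_eq_zero (hT : IsNonsingularPositive T) (f : H) (hf : CFC.sqrt T f = 0) :
    f = 0 :=
  hT.2 f (by rw [← sqrt_sqrt_apply hT.1, hf, map_zero])

theorem sqrt_injective (hT : IsNonsingularPositive T) :
    Function.Injective (CFC.sqrt T : H →L[ℂ] H) :=
  (injective_iff_map_eq_zero _).2 hT.sqrt_apply_eq_zero

theorem denseRange_sqrt (hT : IsNonsingularPositive T) : DenseRange (CFC.sqrt T : H →L[ℂ] H) := by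
  have := denseRange_adjoint_of_injective (CFC.sqrt T) hT.sqrt_apply_eq_zero
  rwa [adjoint_sqrt] at this

/-- An operator between two copies of `T^{1/2}` is determined by the product. -/
theorem sqrt_mul_mul_sqrt_inj (hT : IsNonsingularPositive T) {X Y : H →L[ℂ] H}
    (h : CFC.sqrt T * X * CFC.sqrt T = CFC.sqrt T * Y * CFC.sqrt T) : X = Y := by
  refine ContinuousLinearMap.coeFn_injective
    (hT.denseRange_sqrt.equalizer X.continuous Y.continuous (funext fun z => ?_))
  exact hT.sqrt_injective (congrArg (fun S : H →L[ℂ] H => S z) h)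

theorem add {S : H →L[ℂ] H} (hT : IsNonsingularPositive T) (hS : S.IsPositive) :
    IsNonsingularPositive (T + S) := by
  refine ⟨hT.1.add hS, fun f hf => ?_⟩
  have h1 : RCLike.re ⟪(T + S) f, f⟫_ℂ = 0 := by simp [hf]
  rw [add_apply, inner_add_left, map_add, ← norm_sqrt_apply_sq hT.1,
    ← norm_sqrt_apply_sq hS] at h1
  refine hT.sqrt_apply_eq_zero f (norm_eq_zero.1 ?_)
  nlinarith [sq_nonneg ‖CFC.sqrt T f‖, sq_nonneg ‖CFC.sqrt S f‖]

end IsNonsingularPositive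

theorem norm_sqrt_le_norm_sqrt_add {T S : H →L[ℂ] H} (hT : T.IsPositive) (hS : S.IsPositive)
    (f : H) : ‖CFC.sqrt T f‖ ≤ ‖CFC.sqrt (T + S) f‖ := by
  refine abs_le_of_sq_le_sq' ?_ (norm_nonneg _) |>.2
  rw [norm_sqrt_apply_sq hT, norm_sqrt_apply_sq (hT.add hS), add_apply,
    inner_add_left, map_add, ← norm_sqrt_apply_sq hS]
  nlinarith [sq_nonneg ‖CFC.sqrt S f‖]

/-- The factor `D` in `T^{1/2} = (T + S)^{1/2} D†`. -/
theorem exists_sqrt_eq_comp_sqrt_add {T S : H →L[ℂ] H} (hT : T.IsPositive) (hS : S.IsPositive)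
    (hTS : IsNonsingularPositive (T + S)) :
    ∃ D : H →L[ℂ] H, CFC.sqrt T = CFC.sqrt (T + S) * ContinuousLinearMap.adjoint D ∧
      T = CFC.sqrt (T + S) * (ContinuousLinearMap.adjoint D * D) * CFC.sqrt (T + S) := by
  obtain ⟨D, hD⟩ := exists_comp_eq_of_norm_le (CFC.sqrt (T + S)) (CFC.sqrt T)
    hTS.denseRange_sqrt 1 (fun z => by simpa using norm_sqrt_le_norm_sqrt_add hT hS z)
  have h1 : D * CFC.sqrt (T + S) = CFC.sqrt T := ContinuousLinearMap.ext hD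
  have h2 : CFC.sqrt T = CFC.sqrt (T + S) * ContinuousLinearMap.adjoint D := by
    conv_lhs => rw [← adjoint_sqrt, ← h1]
    rw [ContinuousLinearMap.mul_def, ContinuousLinearMap.adjoint_comp, adjoint_sqrt]
    rfl
  refine ⟨D, h2, ?_⟩
  conv_lhs => rw [← sqrt_mul_self_of_isPositive hT]
  conv_lhs =>
    congr
    · rw [h2]
    · rw [← h1]
  simp only [mul_assoc]

theorem sqrt_smul {T : H →L[ℂ] H} (hT : T.IsPositive) {x : ℝ} (hx : 0 ≤ x) :
    CFC.sqrt ((x : ℂ) • T) = ((√x : ℝ) : ℂ) • CFC.sqrt T := by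
  have hs : (((√x : ℝ) : ℂ) • CFC.sqrt T).IsPositive :=
    (sqrt_isPositive T).smul_of_nonneg (by exact_mod_cast Real.sqrt_nonneg x)
  refine CFC.sqrt_unique ?_ ((ContinuousLinearMap.nonneg_iff_isPositive _).2 hs)
  rw [smul_mul_smul_comm, sqrt_mul_self_of_isPositive hT]
  congr 1
  exact_mod_cast Real.mul_self_sqrt hx

theorem ranSqrt_smul_le {T : H →L[ℂ] H} (hT : T.IsPositive) {x : ℝ} (hx : 0 ≤ x) :
    ranSqrt ((x : ℂ) • T) ≤ ranSqrt T := by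
  rintro _ ⟨f, rfl⟩
  refine ⟨((√x : ℝ) : ℂ) • f, ?_⟩
  change CFC.sqrt T (_ • f) = CFC.sqrt ((x : ℂ) • T) f
  rw [sqrt_smul hT hx, map_smul]
  rfl

/-- The orthogonal projection `P` with `A = (A + C)^{1/2} P (A + C)^{1/2}` for two operators
with disjoint square root ranges. -/
theorem exists_isStarProjection_of_ranSqrt_disjoint {A C : H →L[ℂ] H}
    (hA : IsNonsingularPositive A) (hC : C.IsPositive) (h : ranSqrt C ⊓ ranSqrt A = ⊥) :
    ∃ P : H →L[ℂ] H, IsStarProjection P ∧ A = CFC.sqrt (A + C) * P * CFC.sqrt (A + C) := by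
  have hS := hA.add hC
  obtain ⟨D, hD, hDA⟩ := exists_sqrt_eq_comp_sqrt_add hA.1 hC hS
  have hS' : IsNonsingularPositive (C + A) := by rwa [add_comm]
  obtain ⟨F, hF, hFC⟩ := exists_sqrt_eq_comp_sqrt_add hC hA.1 hS'
  rw [add_comm C A] at hF hFC
  set P := ContinuousLinearMap.adjoint D * D with hP
  set Q := ContinuousLinearMap.adjoint F * F with hQ
  have hPQ : P + Q = 1 := by
    refine hS.sqrt_mul_mul_sqrt_inj ?_
    rw [mul_add, add_mul, ← hDA, ← hFC, mul_one, sqrt_mul_self_of_isPositive hS.1]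
  have hPQ' : P * Q = Q * P := by
    rw [show Q = 1 - P from eq_sub_of_add_eq' hPQ]; noncomm_ring
  have h0 : P * Q = 0 := by
    ext f
    apply hS.sqrt_apply_eq_zero
    -- With `S = A + C`: `S^{1/2} D† = A^{1/2}` and `S^{1/2} F† = C^{1/2}`, so the order `PQ` lands
    -- in `ran A^{1/2}` and the order `QP` in `ran C^{1/2}`.
    have hm : CFC.sqrt (A + C) ((P * Q) f) ∈ ranSqrt C ⊓ ranSqrt A := by
      refine ⟨⟨F (P f), ?_⟩, ⟨D (Q f), ?_⟩⟩
      · rw [hPQ', hF]; rfl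
      · rw [hD]; rfl
    rw [h] at hm
    simpa using hm
  refine ⟨P, ⟨?_, ?_⟩, hDA⟩
  · have : P * (P + Q) = P := by rw [hPQ, mul_one]
    rwa [mul_add, h0, add_zero] at this
  · exact IsSelfAdjoint.star_mul_self D

theorem ranSqrt_le_ranSqrt_add {A C : H →L[ℂ] H} (hA : IsNonsingularPositive A)
    (hC : C.IsPositive) : ranSqrt A ≤ ranSqrt (A + C) := by
  obtain ⟨D, hD, -⟩ := exists_sqrt_eq_comp_sqrt_add hA.1 hC (hA.add hC)
  rintro _ ⟨f, rfl⟩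
  exact ⟨ContinuousLinearMap.adjoint D f, by rw [hD]; rfl⟩

/-- A vector of `ran A^{1/2}` has the form `y = (A + C)^{1/2} g`. If `P y = y`, then `A g = (A + C)
g` and `C g = 0`; if `P y = 0`, then `A g = 0`. -/
theorem hasTrivialIntersections_range {A C P : H →L[ℂ] H} (hA : IsNonsingularPositive A)
    (hC : IsNonsingularPositive C) (hP : IsStarProjection P)
    (h : A = CFC.sqrt (A + C) * P * CFC.sqrt (A + C)) : HasTrivialIntersections A P.range := by
  have hS := hA.add hC.1
  have hAapp (g : H) : A g = CFC.sqrt (A + C) (P (CFC.sqrt (A + C) g)) :=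
    congrArg (fun X : H →L[ℂ] H => X g) h
  constructor
  · refine (Submodule.eq_bot_iff _).2 ?_
    rintro y ⟨⟨f, hf⟩, hy⟩
    obtain ⟨g, rfl⟩ := ranSqrt_le_ranSqrt_add hA hC.1 hy
    have h1 : P (CFC.sqrt (A + C) g) = CFC.sqrt (A + C) g := by
      have h3 := congrArg (fun X : H →L[ℂ] H => X f) hP.isIdempotentElem.eq
      change P f = CFC.sqrt (A + C) g at hf
      rw [← hf]; exact h3
    have h2 := hAapp g
    rw [h1, sqrt_sqrt_apply hS.1] at h2
    have : g = 0 := hC.2 g (by simpa using h2)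
    simp [this]
  · refine (Submodule.eq_bot_iff _).2 ?_
    rintro y ⟨hf, hy⟩
    obtain ⟨g, rfl⟩ := ranSqrt_le_ranSqrt_add hA hC.1 hy
    have h1 : P (CFC.sqrt (A + C) g) = 0 := by
      have := ContinuousLinearMap.orthogonal_range P
      rw [this, hP.isSelfAdjoint.adjoint_eq] at hf
      exact hf
    have : g = 0 := hA.2 g (by rw [hAapp, h1, map_zero])
    simp [this]

end OperatorRanges

/-! ### Distinctness and strong continuity of the projections. -/

section LiftingFamily

open Filter Topology

variable {H : Type*} [NormedAddCommGroup H] [InnerProductSpace ℂ H] [CompleteSpace H]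

/-- The compression of `W` to `ran P` stays injective, since its quadratic form there is that of
`W`. -/
theorem proj_apply_eq_zero_of_compression {W P : H →L[ℂ] H} (hW : IsNonsingularPositive W)
    (hP : IsStarProjection P) (k : H) (h : P (W (P k)) = 0) : P k = 0 := by
  have hPP : P (P k) = P k := congrArg (fun X : H →L[ℂ] H => X k) hP.isIdempotentElem.eq
  refine hW.sqrt_apply_eq_zero _ (norm_eq_zero.1 (pow_eq_zero_iff two_ne_zero |>.1 ?_))
  rw [norm_sqrt_apply_sq hW.1]
  have h1 : ⟪W (P k), P k⟫_ℂ = 0 := by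
    conv_lhs => rw [← hPP, ← ContinuousLinearMap.adjoint_inner_left,
      hP.isSelfAdjoint.adjoint_eq, hPP, h, inner_zero_left]
  simp [h1]

theorem compression_nonneg {W P : H →L[ℂ] H} (hW : W.IsPositive) (hP : IsStarProjection P) :
    0 ≤ P * W * P := by
  have := hW.adjoint_conj P
  rw [hP.isSelfAdjoint.adjoint_eq] at this
  exact (ContinuousLinearMap.nonneg_iff_isPositive _).2 this

/-- If `V P V = s² W P W`, then the compressions of `V` and `s W` to `ran P` agree, and so do their
parts from `ran P` to the complement of `ran P`. -/
theorem proj_mul_eq_of_mul_proj_mul_eq {V W P : H →L[ℂ] H} (hV : V.IsPositive)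
    (hW : IsNonsingularPositive W) (hP : IsStarProjection P) {s : ℝ} (hs : 0 < s)
    (h : V * P * V = ((s : ℂ) * s) • (W * P * W)) : P * V = (s : ℂ) • (P * W) := by
  have hPP : P * P = P := hP.isIdempotentElem.eq
  have hPX (X : H →L[ℂ] H) : P * (P * X) = P * X := by rw [← mul_assoc, hPP]
  have hsW : ((s : ℂ) • W).IsPositive :=
    hW.1.smul_of_nonneg (by exact_mod_cast hs.le)
  -- Both sides are non-negative and have the same square, so uniqueness of the square root applies.
  have e1 : P * V * P = P * ((s : ℂ) • W) * P := by
    rw [← CFC.sqrt_unique rfl (compression_nonneg hV hP),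
      ← CFC.sqrt_unique rfl (compression_nonneg hsW hP)]
    congr 1
    have : P * (V * P * V) * P = P * (((s : ℂ) * s) • (W * P * W)) * P := by rw [h]
    simpa only [mul_assoc, hPX, mul_smul_comm, smul_mul_assoc, smul_smul] using this
  have e2 : P * (W * (P * V)) = P * (W * (P * ((s : ℂ) • W))) := by
    have h1 : P * V * P * V = ((s : ℂ) * s) • (P * (W * (P * W))) := by
      have := congrArg (P * ·) h
      simpa [mul_assoc] using this
    rw [e1] at h1
    have hs' : (s : ℂ) ≠ 0 := by exact_mod_cast hs.ne'
    simp only [mul_assoc, mul_smul_comm, smul_mul_assoc, mul_smul] at h1 ⊢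
    exact smul_right_injective _ hs' h1
  ext f
  have h3 := proj_apply_eq_zero_of_compression hW hP (V f - (s : ℂ) • W f) (by
    have := congrArg (fun X : H →L[ℂ] H => X f) e2
    simp only [mul_apply_eq_comp, smul_apply, map_smul] at this
    simp [this])
  rw [map_sub, sub_eq_zero, map_smul] at h3
  simpa using h3

/-- The rows `P V = P W` and `(1 - P) V = s (1 - P) W` determine the corner `P V (1 - P)` twice, as
`P W (1 - P)` and as `s` times it. Since `s ≠ 1`, the corner vanishes. -/
theorem commute_of_mul_proj_mul_eq {V W P : H →L[ℂ] H} (hV : V.IsPositive)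
    (hW : IsNonsingularPositive W) (hP : IsStarProjection P) {s : ℝ} (hs : 0 < s) (hs1 : s ≠ 1)
    (h : V * P * V = W * P * W)
    (h' : V * (1 - P) * V = ((s : ℂ) * s) • (W * (1 - P) * W)) : P * W = W * P := by
  have h1 := proj_mul_eq_of_mul_proj_mul_eq hV hW hP one_pos (by simpa using h)
  have h2 := proj_mul_eq_of_mul_proj_mul_eq hV hW hP.one_sub hs h'
  have hsV : star V = V := hV.isSelfAdjoint
  have hsW : star W = W := hW.1.isSelfAdjoint
  have hsP : star P = P := hP.isSelfAdjoint
  have h3 := congrArg star h2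
  simp only [star_mul, star_smul, star_sub, star_one, hsV, hsW, hsP] at h3
  have hPP : P * P = P := hP.isIdempotentElem.eq
  have h4 : P * W * (1 - P) = (s : ℂ) • (P * W * (1 - P)) := by
    have e1 : P * V * (1 - P) = P * W * (1 - P) := by rw [h1]; simp
    have e2 : P * V * (1 - P) = (s : ℂ) • (P * W * (1 - P)) := by
      rw [mul_assoc, h3]; simp [mul_assoc]
    exact e1.symm.trans e2
  have h5 : P * W * (1 - P) = 0 := by
    have : ((1 : ℂ) - s) • (P * W * (1 - P)) = 0 := by rw [sub_smul, one_smul, ← h4, sub_self]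
    rcases smul_eq_zero.1 this with h | h
    · exact absurd (by exact_mod_cast (sub_eq_zero.1 h).symm) hs1
    · exact h
  have h6 := congrArg star h5
  simp only [star_mul, star_sub, star_one, hsW, hsP, star_zero] at h6
  rw [mul_sub, mul_one, sub_eq_zero] at h5
  rw [sub_mul, one_mul, sub_eq_zero] at h6
  rw [h5, h6, mul_assoc]

/-- For equi-Lipschitz maps, pointwise convergence on a dense set extends everywhere by an `ε/3`
argument. -/
theorem tendsto_of_denseRange {X Y Z ι : Type*} [PseudoMetricSpace Y] [PseudoMetricSpace Z]
    {l : Filter X} {e : ι → Y} (he : DenseRange e) {F : X → Y → Z} {F₀ : Y → Z} {C : ℝ}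
    (hC : 0 ≤ C) (hF : ∀ᶠ x in l, ∀ y y', dist (F x y) (F x y') ≤ C * dist y y')
    (hF₀ : ∀ y y', dist (F₀ y) (F₀ y') ≤ C * dist y y')
    (h : ∀ i, Tendsto (fun x => F x (e i)) l (𝓝 (F₀ (e i)))) (y : Y) :
    Tendsto (fun x => F x y) l (𝓝 (F₀ y)) := by
  rw [Metric.tendsto_nhds]
  intro ε hε
  have hC' : 0 < 3 * (C + 1) := by positivity
  obtain ⟨i, hi⟩ := he.exists_dist_lt y (show 0 < ε / (3 * (C + 1)) by positivity)
  have hCi : C * dist y (e i) ≤ ε / 3 := by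
    rw [lt_div_iff₀ hC'] at hi
    nlinarith [dist_nonneg (x := y) (y := e i)]
  filter_upwards [hF, Metric.tendsto_nhds.1 (h i) (ε / 3) (by positivity)] with x hx hx'
  have h1 := hx y (e i)
  have h2 := hF₀ y (e i)
  have h3 := dist_triangle4 (F x y) (F x (e i)) (F₀ (e i)) (F₀ y)
  rw [dist_comm (F₀ (e i))] at h3
  linarith

theorem IsStarProjection.norm_apply_le {P : H →L[ℂ] H} (hP : IsStarProjection P) (f : H) :
    ‖P f‖ ≤ ‖f‖ :=
  (P.le_of_opNorm_le hP.norm_le f).trans_eq (one_mul _)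

theorem IsStarProjection.inner_apply_apply {P : H →L[ℂ] H} (hP : IsStarProjection P) (f : H) :
    ⟪P f, P f⟫_ℂ = ⟪P f, f⟫_ℂ := by
  conv_lhs => rw [← ContinuousLinearMap.adjoint_inner_left, hP.isSelfAdjoint.adjoint_eq]
  exact congrArg (fun X : H →L[ℂ] H => ⟪X f, f⟫_ℂ) hP.isIdempotentElem.eq

/-- Weak convergence of orthogonal projections to an orthogonal projection is strong. -/
theorem tendsto_proj_apply_of_tendsto_inner {X : Type*} {l : Filter X} {P : X → H →L[ℂ] H}
    {P₀ : H →L[ℂ] H} (hP : ∀ᶠ x in l, IsStarProjection (P x)) (hP₀ : IsStarProjection P₀) (f : H)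
    (h : ∀ g, Tendsto (fun x => ⟪P x f, g⟫_ℂ) l (𝓝 ⟪P₀ f, g⟫_ℂ)) :
    Tendsto (fun x => P x f) l (𝓝 (P₀ f)) := by
  rw [tendsto_iff_norm_sub_tendsto_zero]
  -- This is `‖P x f - P₀ f‖²` expanded with `‖P x f‖² = ⟪P x f, f⟫`, so only weak limits are
  -- needed.
  have h1 : Tendsto (fun x => RCLike.re ⟪P x f, f⟫_ℂ + ‖P₀ f‖ ^ 2 - 2 * RCLike.re ⟪P x f, P₀ f⟫_ℂ) l
      (𝓝 (RCLike.re ⟪P₀ f, f⟫_ℂ + ‖P₀ f‖ ^ 2 - 2 * RCLike.re ⟪P₀ f, P₀ f⟫_ℂ)) :=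
    (((RCLike.continuous_re.tendsto _).comp (h f)).add_const _).sub
      (((RCLike.continuous_re.tendsto _).comp (h (P₀ f))).const_mul 2)
  rw [← hP₀.inner_apply_apply, ← inner_self_eq_norm_sq (𝕜 := ℂ),
    show ∀ r : ℝ, r + r - 2 * r = 0 from fun r => by ring] at h1
  have h2 : Tendsto (fun x => ‖P x f - P₀ f‖ ^ 2) l (𝓝 0) := by
    refine h1.congr' (hP.mono fun x hx => ?_)
    change _ = ‖P x f - P₀ f‖ ^ 2
    rw [@norm_sub_sq ℂ, ← hx.inner_apply_apply, inner_self_eq_norm_sq (𝕜 := ℂ),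
      inner_self_eq_norm_sq (𝕜 := ℂ)]
    ring
  have h3 := (Real.continuous_sqrt.tendsto 0).comp h2
  simpa [Function.comp_def, Real.sqrt_sq] using h3

theorem tendsto_proj_apply_of_tendsto_sqrt {X : Type*} {l : Filter X} {P W : X → H →L[ℂ] H}
    {A P₀ W₀ : H →L[ℂ] H} (hP : ∀ᶠ x in l, IsStarProjection (P x)) (hP₀ : IsStarProjection P₀)
    (hW : ∀ᶠ x in l, IsSelfAdjoint (W x)) (hW₀ : IsSelfAdjoint W₀) (hd : DenseRange W₀)
    (hlim : Tendsto W l (𝓝 W₀)) (h : ∀ᶠ x in l, A = W x * P x * W x) (h₀ : A = W₀ * P₀ * W₀)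
    (f : H) : Tendsto (fun x => P x f) l (𝓝 (P₀ f)) := by
  refine tendsto_of_denseRange hd (C := 1) zero_le_one
    (hP.mono fun x hx y y' => ?_) (fun y y' => ?_) (fun a => ?_) f
  · simpa [dist_eq_norm, ← map_sub] using hx.norm_apply_le (y - y')
  · simpa [dist_eq_norm, ← map_sub] using hP₀.norm_apply_le (y - y')
  refine tendsto_proj_apply_of_tendsto_inner hP hP₀ _ fun g => ?_
  refine tendsto_of_denseRange (F := fun x g => ⟪P x (W₀ a), g⟫_ℂ)
    (F₀ := fun g => ⟪P₀ (W₀ a), g⟫_ℂ) hd (norm_nonneg (W₀ a))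
    (hP.mono fun x hx y y' => ?_) (fun y y' => ?_) (fun b => ?_) g
  · rw [dist_eq_norm, ← inner_sub_right, dist_eq_norm]
    exact (norm_inner_le_norm _ _).trans (by gcongr; exact hx.norm_apply_le _)
  · rw [dist_eq_norm, ← inner_sub_right, dist_eq_norm]
    exact (norm_inner_le_norm _ _).trans (by gcongr; exact hP₀.norm_apply_le _)
  have hlim' (c : H) : Tendsto (fun x => W x c) l (𝓝 (W₀ c)) :=
    ((ContinuousLinearMap.apply ℂ H c).continuous.tendsto W₀).comp hlim
  have hinner {W P : H →L[ℂ] H} (hW : IsSelfAdjoint W) (h : A = W * P * W) :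
      ⟪P (W a), W b⟫_ℂ = ⟪A a, b⟫_ℂ := by
    rw [← ContinuousLinearMap.adjoint_inner_left, hW.adjoint_eq, h]; rfl
  rw [tendsto_iff_norm_sub_tendsto_zero]
  have hz : Tendsto (fun x => ‖W₀ a - W x a‖ * ‖W x b‖ + ‖W₀ a‖ * ‖W₀ b - W x b‖) l (𝓝 0) := by
    have h1 := ((hlim' a).const_sub (W₀ a)).norm.mul (hlim' b).norm
    have h2 := ((hlim' b).const_sub (W₀ b)).norm.const_mul ‖W₀ a‖
    simpa using h1.add h2
  refine squeeze_zero' (Eventually.of_forall fun _ => norm_nonneg _) ?_ hz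
  filter_upwards [hP, hW, h] with x hPx hWx hx
  -- The form `⟪P x (W x a), W x b⟫ = ⟪A a, b⟫` does not depend on `x`, so only the differences of
  -- `W x` and `W₀` remain.
  have e : ⟪P x (W₀ a), W₀ b⟫_ℂ - ⟪P₀ (W₀ a), W₀ b⟫_ℂ =
      ⟪P x (W₀ a - W x a), W x b⟫_ℂ + ⟪P x (W₀ a), W₀ b - W x b⟫_ℂ := by
    rw [hinner hW₀ h₀, ← hinner hWx hx, map_sub, inner_sub_left, inner_sub_right]
    ring
  rw [e]
  refine (norm_add_le _ _).trans (add_le_add ?_ ?_)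
  · exact (norm_inner_le_norm _ _).trans (by gcongr; exact hPx.norm_apply_le _)
  · exact (norm_inner_le_norm _ _).trans (by gcongr; exact hPx.norm_apply_le _)

variable {A B : H →L[ℂ] H}

omit [CompleteSpace H] in
theorem IsNonsingularPositive.smul (hB : IsNonsingularPositive B) {x : ℝ} (hx : 0 < x) :
    IsNonsingularPositive ((x : ℂ) • B) := by
  refine ⟨hB.1.smul_of_nonneg (by exact_mod_cast hx.le), fun f hf => hB.2 f ?_⟩
  have hx' : (x : ℂ) ≠ 0 := by exact_mod_cast hx.ne'
  exact (smul_eq_zero.1 hf).resolve_left hx'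

theorem IsNonsingularPositive.sqrt (hA : IsNonsingularPositive A) :
    IsNonsingularPositive (CFC.sqrt A) :=
  ⟨sqrt_isPositive A, hA.sqrt_apply_eq_zero⟩

theorem IsNonsingularPositive.add_smul (hA : IsNonsingularPositive A)
    (hB : IsNonsingularPositive B) {x : ℝ} (hx : 0 < x) :
    IsNonsingularPositive (A + (x : ℂ) • B) :=
  hA.add (hB.smul hx).1

theorem exists_isLifting (hA : IsNonsingularPositive A) (hB : IsNonsingularPositive B)
    (h : ranSqrt B ⊓ ranSqrt A = ⊥) {x : ℝ} (hx : 0 < x) :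
    ∃ P : H →L[ℂ] H, IsLifting A B x P :=
  exists_isStarProjection_of_ranSqrt_disjoint hA (hB.smul hx).1
    (eq_bot_iff.2 ((inf_le_inf_right _ (ranSqrt_smul_le hB.1 hx.le)).trans h.le))

namespace IsLifting

theorem unique {P Q : H →L[ℂ] H} {x : ℝ} (hA : IsNonsingularPositive A)
    (hB : IsNonsingularPositive B) (hx : 0 < x) (hQ : IsLifting A B x Q) (hP : IsLifting A B x P) :
    Q = P :=
  (hA.add_smul hB hx).sqrt_mul_mul_sqrt_inj (hQ.2.symm.trans hP.2)

theorem smul_eq {P : H →L[ℂ] H} {x : ℝ} (hA : IsNonsingularPositive A)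
    (hB : IsNonsingularPositive B) (hx : 0 < x) (hP : IsLifting A B x P) :
    (x : ℂ) • B = CFC.sqrt (A + (x : ℂ) • B) * (1 - P) * CFC.sqrt (A + (x : ℂ) • B) := by
  rw [mul_sub, sub_mul, ← hP.2, mul_one, sqrt_mul_self_of_isPositive (hA.add_smul hB hx).1,
    add_sub_cancel_left]

theorem eq_of_eq [Nontrivial H] {P : H →L[ℂ] H} {x y : ℝ} (hA : IsNonsingularPositive A)
    (hB : IsNonsingularPositive B) (hx : 0 < x) (hy : 0 < y) (hPx : IsLifting A B x P)
    (hPy : IsLifting A B y P) : x = y := by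
  by_contra hxy
  -- The ratio of `yB` to `xB` is `s²` with `s = √(y/x)`.
  have hs : 0 < √(y / x) := Real.sqrt_pos.2 (div_pos hy hx)
  have hss : ((√(y / x) : ℝ) : ℂ) * (√(y / x) : ℝ) = (y : ℂ) / x := by
    rw [← Complex.ofReal_mul, Real.mul_self_sqrt (div_pos hy hx).le, Complex.ofReal_div]
  have hx' : (x : ℂ) ≠ 0 := by exact_mod_cast hx.ne'
  have hcomm := commute_of_mul_proj_mul_eq (sqrt_isPositive (A + (y : ℂ) • B))
    (hA.add_smul hB hx).sqrt hPx.1 hs (fun h => hxy ?_) (hPy.2.symm.trans hPx.2)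
    (by rw [← hPy.smul_eq hA hB hy, ← hPx.smul_eq hA hB hx, hss, smul_smul,
      div_mul_cancel₀ _ hx'])
  · obtain ⟨f, hf⟩ := exists_ne (0 : H)
    refine hf (hA.2 f ?_)
    -- Commutation turns the factorization into `A = P (A + xB)`.
    have hm : A f ∈ P.range ⊓ ranSqrt A := by
      refine ⟨⟨CFC.sqrt (A + (x : ℂ) • B) (CFC.sqrt (A + (x : ℂ) • B) f), ?_⟩,
        ⟨CFC.sqrt A f, sqrt_sqrt_apply hA.1 f⟩⟩
      have := hPx.2
      rw [← hcomm] at this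
      exact (congrArg (fun X : H →L[ℂ] H => X f) this).symm
    rw [(hasTrivialIntersections_range hA (hB.smul hx) hPx.1 hPx.2).1] at hm
    simpa using hm
  · rw [Real.sqrt_eq_one, div_eq_one_iff_eq hx.ne'] at h
    exact h.symm

theorem continuousOn {P : ℝ → H →L[ℂ] H} (hA : IsNonsingularPositive A)
    (hB : IsNonsingularPositive B) (hP : ∀ x, 0 < x → IsLifting A B x (P x)) (h : H) :
    ContinuousOn (fun x => P x h) (Set.Ioi 0) := by
  intro x₀ hx₀
  have hcont : ContinuousOn (fun x : ℝ => CFC.sqrt (A + (x : ℂ) • B)) (Set.Ioi 0) := by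
    refine CFC.continuousOn_sqrt.comp (Continuous.continuousOn (by fun_prop)) fun x hx => ?_
    exact (ContinuousLinearMap.nonneg_iff_isPositive _).2 (hA.add_smul hB hx).1
  exact tendsto_proj_apply_of_tendsto_sqrt (A := A)
    (eventually_mem_nhdsWithin.mono fun x hx => (hP x hx).1) (hP x₀ hx₀).1
    (Eventually.of_forall fun x => (sqrt_isPositive (A + (x : ℂ) • B)).isSelfAdjoint)
    (sqrt_isPositive (A + (x₀ : ℂ) • B)).isSelfAdjoint
    (hA.add_smul hB hx₀).denseRange_sqrt (hcont x₀ hx₀)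
    (eventually_mem_nhdsWithin.mono fun x hx => (hP x hx).2) (hP x₀ hx₀).2 h

end IsLifting

/-- The one-parameter family of orthogonal projections generated by `B`. -/
theorem exists_liftingFamily [Nontrivial H] (hA : IsNonsingularPositive A)
    (hB : IsNonsingularPositive B) (h : ranSqrt B ⊓ ranSqrt A = ⊥) :
    ∃ P : ℝ → H →L[ℂ] H,
        (∀ x : ℝ, 0 < x →
          IsLifting A B x (P x) ∧
          (∀ Q : H →L[ℂ] H, IsLifting A B x Q → Q = P x) ∧
          (x : ℂ) • B =
            CFC.sqrt (A + (x : ℂ) • B) * (1 - P x) * CFC.sqrt (A + (x : ℂ) • B) ∧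
          IsClosed ((P x).range : Set H) ∧
          HasTrivialIntersections A (P x).range) ∧
        Set.InjOn (fun x : ℝ => (P x).range) (Set.Ioi 0) ∧
        ∀ h : H, ContinuousOn (fun x : ℝ => P x h) (Set.Ioi 0) := by
  choose! P hP using fun (x : ℝ) (hx : 0 < x) => exists_isLifting hA hB h hx
  refine ⟨P, fun x hx => ⟨hP x hx, fun Q hQ => hQ.unique hA hB hx (hP x hx),
    (hP x hx).smul_eq hA hB hx,
    ContinuousLinearMap.IsIdempotentElem.isClosed_range (hP x hx).1.isIdempotentElem,
    hasTrivialIntersections_range hA (hB.smul hx) (hP x hx).1 (hP x hx).2⟩, ?_,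
    IsLifting.continuousOn hA hB hP⟩
  intro x hx y hy hxy
  have hxy' : P y = P x :=
    (ContinuousLinearMap.IsStarProjection.ext_iff (hP y hy).1 (hP x hx).1).2 hxy.symm
  exact (hP x hx).eq_of_eq hA hB hx hy (hxy' ▸ hP y hy)

end LiftingFamily

/-! ### Construction of `B` by Baire category. -/

section DisjointRange

open Filter Topology TopologicalSpace

variable {H : Type*} [NormedAddCommGroup H] [InnerProductSpace ℂ H]

/-- Scaling of a sequence of vectors by continuous positive weights that make it absolutely
summable. -/
noncomputable def dampedSeq (f : ℕ → H) (i : ℕ) : H := (((1 / 2) ^ i / (1 + ‖f i‖) : ℝ) : ℂ) • f i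

theorem norm_dampedSeq_le (f : ℕ → H) (i : ℕ) : ‖dampedSeq f i‖ ≤ (1 / 2) ^ i := by
  have h : 0 < 1 + ‖f i‖ := by positivity
  rw [dampedSeq, norm_smul, Complex.norm_real, Real.norm_of_nonneg (by positivity),
    div_mul_eq_mul_div,
    div_le_iff₀ h]
  gcongr
  linarith

theorem continuous_dampedSeq (i : ℕ) : Continuous fun f : ℕ → H => dampedSeq f i := by
  unfold dampedSeq
  refine Continuous.smul (Complex.continuous_ofReal.comp (Continuous.div ?_ ?_ fun f => ?_)) ?_
  · fun_prop
  · fun_prop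
  · positivity
  · fun_prop

omit [InnerProductSpace ℂ H] in
theorem dampedSeq_weight_ne_zero (f : ℕ → H) (i : ℕ) :
    (((1 / 2) ^ i / (1 + ‖f i‖) : ℝ) : ℂ) ≠ 0 := by
  have : (0 : ℝ) < (1 / 2) ^ i / (1 + ‖f i‖) := by positivity
  exact_mod_cast this.ne'

theorem continuous_tsum_smul_dampedSeq [CompleteSpace H] :
    Continuous fun p : (ℕ → H) × (ℕ → Metric.closedBall (0 : ℂ) 1) =>
      ∑' i, (p.2 i : ℂ) • dampedSeq p.1 i := by
  refine continuous_tsum (u := fun i => (1 / 2 : ℝ) ^ i) (fun i => ?_) summable_geometric_two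
    fun i p => ?_
  · exact Continuous.smul (by fun_prop) ((continuous_dampedSeq i).comp continuous_fst)
  · rw [norm_smul]
    have h1 : ‖(p.2 i : ℂ)‖ ≤ 1 := mem_closedBall_zero_iff.1 (p.2 i).2
    calc _ ≤ 1 * (1 / 2 : ℝ) ^ i :=
          mul_le_mul h1 (norm_dampedSeq_le _ _) (norm_nonneg _) zero_le_one
      _ = _ := one_mul _

/-- The sequences none of whose damped combinations with coefficients in the unit disc, the `k`-th
of modulus at least `1 / (m + 1)`, lie in `F`. -/
noncomputable def avoidingSeqs (F : Set H) (k m : ℕ) : Set (ℕ → H) :=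
  {f | ∀ c ∈ {c : ℕ → Metric.closedBall (0 : ℂ) 1 | 1 / ((m : ℝ) + 1) ≤ ‖(c k : ℂ)‖},
    ∑' i, (c i : ℂ) • dampedSeq f i ∉ F}

/-- The admissible coefficients form a compact subset of a product of discs; the bound `1 / (m + 1)`
replaces the non-closed condition `c k ≠ 0`. Joint continuity of the sum then gives openness. -/
theorem isOpen_avoidingSeqs [CompleteSpace H] {F : Set H} (hF : IsClosed F) (k m : ℕ) :
    IsOpen (avoidingSeqs F k m) := by
  have hK : IsCompact {c : ℕ → Metric.closedBall (0 : ℂ) 1 | 1 / ((m : ℝ) + 1) ≤ ‖(c k : ℂ)‖} :=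
    (isClosed_le (by fun_prop) (by fun_prop)).isCompact
  refine isOpen_iff_mem_nhds.2 fun f hf => ?_
  exact hK.eventually_forall_of_forall_eventually fun c hc =>
    (continuous_tsum_smul_dampedSeq.tendsto (f, c)).eventually (hF.isOpen_compl.mem_nhds (hf c hc))

theorem dense_compl_submodule {R : Submodule ℂ H} (hR : R ≠ ⊤) : Dense (R : Set H)ᶜ := by
  rw [← interior_eq_empty_iff_dense_compl]
  by_contra h
  exact hR (R.eq_top_of_nonempty_interior' (Set.nonempty_iff_ne_empty.2 h))

theorem dense_avoidingSeqs {F : Set H} {R : Submodule ℂ H} (hF : F ⊆ R)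
    (hR : ∀ s : Set H, s.Finite → R ⊔ Submodule.span ℂ s ≠ ⊤) (k m : ℕ) :
    Dense (avoidingSeqs F k m) := by
  classical
  refine dense_iff_inter_open.2 fun U hU ⟨f₀, hf₀⟩ => ?_
  obtain ⟨I, u, hu, hIU⟩ := isOpen_pi_iff.1 hU f₀ hf₀
  set G := R ⊔ Submodule.span ℂ (f₀ '' (I : Set ℕ)) with hG
  have hd := dense_compl_submodule (hR _ (I.finite_toSet.image f₀))
  obtain ⟨y, hyu, hyG⟩ : ∃ y, (k ∈ I → y ∈ u k) ∧ y ∉ G := by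
    by_cases hk : k ∈ I
    · obtain ⟨y, h1, h2⟩ := dense_iff_inter_open.1 hd (u k) (hu k hk).1 ⟨_, (hu k hk).2⟩
      exact ⟨y, fun _ => h1, h2⟩
    · obtain ⟨y, hy⟩ := hd.nonempty
      exact ⟨y, fun h => absurd h hk, hy⟩
  -- A basic open set constrains only the coordinates in `I`. Zeroing the others makes every
  -- combination finite, and membership in `F` would put `y` in `G`.
  let f : ℕ → H := fun i => if i = k then y else if i ∈ I then f₀ i else 0
  refine ⟨f, hIU fun i hi => ?_, fun c hc hcF => hyG ?_⟩
  · by_cases hik : i = k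
    · subst hik
      simpa [f] using hyu hi
    · have : i ∈ I := hi
      simpa [f, hik, this] using (hu i hi).2
  have hck : (c k : ℂ) ≠ 0 := by
    intro h0
    have h1 : 1 / ((m : ℝ) + 1) ≤ ‖(c k : ℂ)‖ := hc
    rw [h0, norm_zero] at h1
    have : 0 < 1 / ((m : ℝ) + 1) := by positivity
    linarith
  have hsum : ∑' i, (c i : ℂ) • dampedSeq f i =
      (c k : ℂ) • dampedSeq f k + ∑ i ∈ I.erase k, (c i : ℂ) • dampedSeq f i := by
    rw [← Finset.sum_insert (f := fun i => (c i : ℂ) • dampedSeq f i) (Finset.notMem_erase k I),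
      tsum_eq_sum fun i hi => ?_]
    have h1 : i ≠ k := fun h => hi (by simp [h])
    have h2 : i ∉ I := fun h => hi (by simp [h, h1])
    simp [dampedSeq, f, h1, h2]
  have h1 : ∑' i, (c i : ℂ) • dampedSeq f i ∈ G := Submodule.mem_sup_left (hF hcF)
  have h2 : ∑ i ∈ I.erase k, (c i : ℂ) • dampedSeq f i ∈ G := by
    refine Submodule.sum_mem _ fun i hi => G.smul_mem _ (G.smul_mem _ ?_)
    obtain ⟨hik, hiI⟩ := Finset.mem_erase.1 hi
    refine Submodule.mem_sup_right (Submodule.subset_span ⟨i, hiI, ?_⟩)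
    simp [f, hik, hiI]
  rw [hsum, G.add_mem_iff_left h2, G.smul_mem_iff hck, dampedSeq,
    G.smul_mem_iff (dampedSeq_weight_ne_zero f k)] at h1
  simpa [f] using h1

omit [InnerProductSpace ℂ H] in
theorem dense_setOf_exists_mem {V : Set H} (hV : V.Nonempty) :
    Dense {f : ℕ → H | ∃ i, f i ∈ V} := by
  classical
  refine dense_iff_inter_open.2 fun U hU ⟨f₀, hf₀⟩ => ?_
  obtain ⟨I, u, hu, hIU⟩ := isOpen_pi_iff.1 hU f₀ hf₀
  obtain ⟨N, hN⟩ := Infinite.exists_notMem_finset I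
  obtain ⟨y, hy⟩ := hV
  refine ⟨Function.update f₀ N y, hIU fun i hi => ?_, N, by simpa using hy⟩
  have : i ≠ N := fun h => hN (h ▸ hi)
  simpa [this] using (hu i hi).2

/-- A generic sequence in `H` is dense and its damped combinations avoid a given countable union of
closed sets that, together with any finite set, does not span `H`. -/
theorem exists_seq_tsum_notMem [CompleteSpace H] [SeparableSpace H] {F : ℕ → Set H}
    (hFc : ∀ n, IsClosed (F n)) {R : Submodule ℂ H} (hFR : ∀ n, F n ⊆ R)
    (hRF : ∀ y ∈ R, ∃ n, y ∈ F n)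
    (hR : ∀ s : Set H, s.Finite → R ⊔ Submodule.span ℂ s ≠ ⊤) :
    ∃ f : ℕ → H, DenseRange f ∧
      ∀ c : ℕ → ℂ, (∀ i, ‖c i‖ ≤ 1) → c ≠ 0 → ∑' i, c i • dampedSeq f i ∉ R := by
  have : SecondCountableTopology H := UniformSpace.secondCountable_of_separable H
  have h1 : ∀ᶠ f in residual (ℕ → H), ∀ p : ℕ × ℕ × ℕ, f ∈ avoidingSeqs (F p.1) p.2.1 p.2.2 :=
    eventually_countable_forall.2 fun p => residual_of_dense_open
      (isOpen_avoidingSeqs (hFc _) _ _) (dense_avoidingSeqs (hFR _) hR _ _)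
  have h2 : ∀ᶠ f in residual (ℕ → H),
      ∀ V : countableBasis H, f ∈ {f : ℕ → H | ∃ i, f i ∈ V.1} := by
    refine eventually_countable_forall.2 fun V => residual_of_dense_open ?_
      (dense_setOf_exists_mem (nonempty_of_mem_countableBasis V.2))
    simp only [Set.ofPred_exists]
    exact isOpen_iUnion fun i => (isOpen_of_mem_countableBasis V.2).preimage (continuous_apply i)
  obtain ⟨f, hf1, hf2⟩ := (dense_of_mem_residual (h1.and h2)).nonempty
  refine ⟨f, (isBasis_countableBasis H).dense_iff.2 fun V hV _ => ?_, fun c hc hc0 hcR => ?_⟩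
  · obtain ⟨i, hi⟩ := hf2 ⟨V, hV⟩
    exact ⟨f i, hi, i, rfl⟩
  · obtain ⟨k, hk⟩ := Function.ne_iff.1 hc0
    obtain ⟨m, hm⟩ := exists_nat_one_div_lt (norm_pos_iff.2 hk)
    obtain ⟨n, hn⟩ := hRF _ hcR
    exact hf1 (n, k, m) (fun i => ⟨c i, by simpa using hc i⟩) hm.le hn

variable [CompleteSpace H]

/-- Each bound with fixed `n` is a closed condition on `y`, so the range is a countable union of
closed sets. The converse uses Douglas factorization and Riesz representation. -/
theorem mem_range_iff_exists_forall_norm_inner_le {G : H →L[ℂ] H} (hG : IsSelfAdjoint G)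
    (hd : DenseRange G) (y : H) :
    y ∈ G.range ↔ ∃ n : ℕ, ∀ z, ‖⟪y, z⟫_ℂ‖ ≤ n * ‖G z‖ := by
  constructor
  · rintro ⟨h, rfl⟩
    obtain ⟨n, hn⟩ := exists_nat_ge ‖h‖
    refine ⟨n, fun z => ?_⟩
    change ‖⟪G h, z⟫_ℂ‖ ≤ _
    rw [← hG.adjoint_eq, ContinuousLinearMap.adjoint_inner_left, hG.adjoint_eq]
    exact (norm_inner_le_norm _ _).trans (by gcongr)
  · rintro ⟨n, hn⟩
    obtain ⟨D, hD⟩ := exists_comp_eq_of_norm_le G (innerSL ℂ y) hd n hn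
    refine ⟨(InnerProductSpace.toDual ℂ H).symm D, ext_inner_right ℂ fun z => ?_⟩
    change ⟪G _, z⟫_ℂ = _
    conv_lhs => rw [← hG.adjoint_eq]
    rw [ContinuousLinearMap.adjoint_inner_left,
      InnerProductSpace.toDual_symm_apply, hD, innerSL_apply_apply]

/-- The range of an injective operator with dense range different from the whole space has infinite
codimension. -/
theorem range_sup_span_ne_top {G : H →L[ℂ] H} (hG : Function.Injective G) (hd : DenseRange G)
    (hran : G.range ≠ ⊤) {s : Set H} (hs : s.Finite) : G.range ⊔ Submodule.span ℂ s ≠ ⊤ := by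
  intro h
  obtain ⟨C, hC⟩ := Submodule.exists_isCompl G.range
  have : FiniteDimensional ℂ (Submodule.span ℂ s) := FiniteDimensional.span_of_finite ℂ hs
  have hsurj : Function.Surjective (G.range.mkQ ∘ₗ (Submodule.span ℂ s).subtype) := by
    intro q
    obtain ⟨y, rfl⟩ := G.range.mkQ_surjective q
    obtain ⟨a, ha, b, hb, rfl⟩ := Submodule.mem_sup.1 (h ▸ Submodule.mem_top : y ∈ _)
    refine ⟨⟨b, hb⟩, ?_⟩
    have : G.range.mkQ a = 0 := (Submodule.Quotient.mk_eq_zero _).2 ha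
    simp only [LinearMap.comp_apply, Submodule.subtype_apply, map_add, this, zero_add]
  have : FiniteDimensional ℂ (H ⧸ G.range) := Module.Finite.of_surjective _ hsurj
  have : FiniteDimensional ℂ C := (Submodule.quotientEquivOfIsCompl _ _ hC).finiteDimensional
  -- An injective bounded operator whose range has a closed complement has closed range; density
  -- then makes it everything.
  have hcl := G.closed_complemented_range_of_isCompl_of_ker_eq_bot C hC C.closed_of_finiteDimensional
    (LinearMap.ker_eq_bot.2 hG)
  refine hran (SetLike.coe_injective ?_)
  have : closure (G.range : Set H) = Set.univ := hd.closure_range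
  rw [← hcl.closure_eq, this]
  rfl

omit [CompleteSpace H] in
theorem norm_lp_smul_dampedSeq_le (f : ℕ → H) (c : lp (fun _ : ℕ => ℂ) 2) (i : ℕ) :
    ‖c i • dampedSeq f i‖ ≤ ‖c‖ * (1 / 2) ^ i := by
  rw [norm_smul]
  gcongr
  · exact lp.norm_apply_le_norm two_ne_zero c i
  · exact norm_dampedSeq_le f i

theorem summable_lp_smul_dampedSeq (f : ℕ → H) (c : lp (fun _ : ℕ => ℂ) 2) :
    Summable fun i => c i • dampedSeq f i :=
  Summable.of_norm_bounded (summable_geometric_two.mul_left ‖c‖) (norm_lp_smul_dampedSeq_le f c)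

/-- The synthesis operator `c ↦ ∑ cᵢ vᵢ` of the damped sequence `v`. -/
noncomputable def synthesis (f : ℕ → H) : lp (fun _ : ℕ => ℂ) 2 →L[ℂ] H :=
  LinearMap.mkContinuous
    { toFun := fun c => ∑' i, c i • dampedSeq f i
      map_add' := fun c d => by
        rw [← (summable_lp_smul_dampedSeq f c).tsum_add (summable_lp_smul_dampedSeq f d)]
        simp [add_smul]
      map_smul' := fun a c => by
        rw [RingHom.id_apply, ← (summable_lp_smul_dampedSeq f c).tsum_const_smul]
        simp [mul_smul] } 2 fun c => by
    refine tsum_of_norm_bounded ?_ (norm_lp_smul_dampedSeq_le f c)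
    rw [mul_comm 2]
    exact hasSum_geometric_two.mul_left ‖c‖

theorem synthesis_apply (f : ℕ → H) (c : lp (fun _ : ℕ => ℂ) 2) :
    synthesis f c = ∑' i, c i • dampedSeq f i := rfl

theorem synthesis_single (f : ℕ → H) (i : ℕ) :
    synthesis f (lp.single 2 i (1 : ℂ)) = dampedSeq f i := by
  rw [synthesis_apply, tsum_eq_single i fun j hj => ?_]
  · simp
  · simp [hj]

theorem adjoint_synthesis_injective {f : ℕ → H} (hf : DenseRange f) (h : H)
    (hh : ContinuousLinearMap.adjoint (synthesis f) h = 0) : h = 0 := by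
  have h1 (i : ℕ) : ⟪f i, h⟫_ℂ = 0 := by
    have h2 : ⟪dampedSeq f i, h⟫_ℂ = 0 := by
      rw [← synthesis_single, ← ContinuousLinearMap.adjoint_inner_right, hh, inner_zero_right]
    rw [dampedSeq, inner_smul_left] at h2
    exact (mul_eq_zero.1 h2).resolve_left
      ((map_ne_zero _).2 (dampedSeq_weight_ne_zero f i))
  have h3 : (fun y : H => ⟪y, h⟫_ℂ) = fun _ => 0 :=
    hf.equalizer (by fun_prop) continuous_const (funext h1)
  exact inner_self_eq_zero.1 (congrFun h3 h)

/-- Existence of a non-negative operator with trivial kernel whose square root has range disjoint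
from `ran A^{1/2}`. -/
theorem exists_ranSqrt_disjoint [SeparableSpace H] {A : H →L[ℂ] H} (hA : IsNonsingularPositive A)
    (hran : Set.range A ≠ Set.univ) :
    ∃ B : H →L[ℂ] H, IsNonsingularPositive B ∧ ranSqrt B ⊓ ranSqrt A = ⊥ := by
  have hG : IsSelfAdjoint (CFC.sqrt A) := (sqrt_isPositive A).isSelfAdjoint
  have htop : ranSqrt A ≠ ⊤ := by
    intro h
    refine hran (Set.range_eq_univ.2 fun y => ?_)
    obtain ⟨g, hg⟩ : y ∈ ranSqrt A := h ▸ Submodule.mem_top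
    obtain ⟨k, rfl⟩ : g ∈ ranSqrt A := h ▸ Submodule.mem_top
    exact ⟨k, (sqrt_sqrt_apply hA.1 k).symm.trans hg⟩
  have hmem := mem_range_iff_exists_forall_norm_inner_le hG hA.denseRange_sqrt
  obtain ⟨f, hfd, hf⟩ := exists_seq_tsum_notMem
    (F := fun n : ℕ => {y | ∀ z, ‖⟪y, z⟫_ℂ‖ ≤ n * ‖CFC.sqrt A z‖}) (R := ranSqrt A)
    (fun n => by
      simp only [Set.ofPred_forall]
      exact isClosed_iInter fun z => isClosed_le (by fun_prop) continuous_const)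
    (fun n y hy => (hmem y).2 ⟨n, hy⟩) (fun y hy => (hmem y).1 hy)
    (fun s hs => range_sup_span_ne_top hA.sqrt_injective hA.denseRange_sqrt htop hs)
  set T := synthesis f with hT
  have hTdisj (c : lp (fun _ : ℕ => ℂ) 2) (hc : T c ∈ ranSqrt A) : c = 0 := by
    by_contra h0
    have hn : ‖c‖ ≠ 0 := norm_ne_zero_iff.2 h0
    -- Normalizing in `ℓ²` puts every coefficient in the unit disc, as `hf` requires.
    set d := ((‖c‖⁻¹ : ℝ) : ℂ) • c with hd
    have hd1 : ‖d‖ = 1 := by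
      rw [hd, norm_smul, Complex.norm_real, norm_inv, norm_norm, inv_mul_cancel₀ hn]
    refine hf d (fun i => (lp.norm_apply_le_norm two_ne_zero d i).trans hd1.le) (fun h => ?_) ?_
    · have : d = 0 := Subtype.ext h
      rw [this, norm_zero] at hd1
      exact zero_ne_one hd1
    · rw [← synthesis_apply, ← hT, hd, map_smul]
      exact Submodule.smul_mem _ _ hc
  have hTinj (c : lp (fun _ : ℕ => ℂ) 2) (hc : T c = 0) : c = 0 :=
    hTdisj c (hc ▸ Submodule.zero_mem _)
  have hnorm (z : H) : RCLike.re ⟪(T ∘L ContinuousLinearMap.adjoint T) z, z⟫_ℂ =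
      ‖ContinuousLinearMap.adjoint T z‖ ^ 2 := by
    rw [ContinuousLinearMap.comp_apply, ← ContinuousLinearMap.adjoint_inner_right,
      inner_self_eq_norm_sq]
  have hB := ContinuousLinearMap.isPositive_self_comp_adjoint T
  refine ⟨T ∘L ContinuousLinearMap.adjoint T, ⟨hB, fun h hh => ?_⟩, ?_⟩
  · refine adjoint_synthesis_injective hfd h (norm_eq_zero.1 (pow_eq_zero_iff two_ne_zero |>.1 ?_))
    rw [← hnorm, hh, inner_zero_left, map_zero]
  · obtain ⟨D, hD⟩ := exists_comp_eq_of_norm_le (ContinuousLinearMap.adjoint T)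
      (CFC.sqrt (T ∘L ContinuousLinearMap.adjoint T)) (denseRange_adjoint_of_injective T hTinj) 1
      (fun z => by
        rw [one_mul]
        refine (abs_le_of_sq_le_sq' (le_of_eq ?_) (norm_nonneg _)).2
        rw [norm_sqrt_apply_sq hB, hnorm])
    -- This puts `ran (T T†)^{1/2}` inside `ran T`, which meets `ran A^{1/2}` only in zero.
    have hD' : CFC.sqrt (T ∘L ContinuousLinearMap.adjoint T) =
        T ∘L ContinuousLinearMap.adjoint D := by
      rw [← adjoint_sqrt, ← ContinuousLinearMap.ext (f := D ∘L ContinuousLinearMap.adjoint T) hD,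
        ContinuousLinearMap.adjoint_comp, ContinuousLinearMap.adjoint_adjoint]
    refine (Submodule.eq_bot_iff _).2 ?_
    rintro y ⟨⟨g, rfl⟩, hy⟩
    change CFC.sqrt (T ∘L ContinuousLinearMap.adjoint T) g ∈ ranSqrt A at hy
    change CFC.sqrt (T ∘L ContinuousLinearMap.adjoint T) g = 0
    rw [hD'] at hy ⊢
    exact (congrArg T (hTdisj (ContinuousLinearMap.adjoint D g) hy)).trans (map_zero T)

end DisjointRange

theorem theorem3p7 {H : Type*} [NormedAddCommGroup H] [InnerProductSpace ℂ H] [CompleteSpace H]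
    [TopologicalSpace.SeparableSpace H] (A : H →L[ℂ] H) (hA : IsNonsingularPositive A)
    (hran : Set.range A ≠ Set.univ) :
    -- a continuum of closed subspaces with the trivial intersection property
    (∃ S : Set (Submodule ℂ H), #S = 𝔠 ∧
      ∀ M ∈ S, IsClosed (M : Set H) ∧ HasTrivialIntersections A M) ∧
    -- admissible operators `B` exist
    (∃ B : H →L[ℂ] H, IsNonsingularPositive B ∧ ranSqrt B ⊓ ranSqrt A = ⊥) ∧
    -- each admissible `B` generates the one-parameter family `P(x)`, `x > 0`
    (∀ B : H →L[ℂ] H, IsNonsingularPositive B → ranSqrt B ⊓ ranSqrt A = ⊥ →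
      ∃ P : ℝ → H →L[ℂ] H,
        (∀ x : ℝ, 0 < x →
          IsLifting A B x (P x) ∧
          (∀ Q : H →L[ℂ] H, IsLifting A B x Q → Q = P x) ∧
          (x : ℂ) • B =
            CFC.sqrt (A + (x : ℂ) • B) * (1 - P x) * CFC.sqrt (A + (x : ℂ) • B) ∧
          IsClosed ((P x).range : Set H) ∧
          HasTrivialIntersections A (P x).range) ∧
        Set.InjOn (fun x : ℝ => (P x).range) (Set.Ioi 0) ∧
        ∀ h : H, ContinuousOn (fun x : ℝ => P x h) (Set.Ioi 0)) := by
  -- On the zero space all the ranges would coincide.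
  have : Nontrivial H := by
    by_contra h
    rw [not_nontrivial_iff_subsingleton] at h
    exact hran (Set.range_eq_univ.2 fun y => ⟨0, Subsingleton.elim _ _⟩)
  have hex := exists_ranSqrt_disjoint hA hran
  refine ⟨?_, hex, fun B hB hBA => exists_liftingFamily hA hB hBA⟩
  obtain ⟨B, hB, hBA⟩ := hex
  obtain ⟨P, hP, hinj, -⟩ := exists_liftingFamily hA hB hBA
  refine ⟨(fun x : ℝ => (P x).range) '' Set.Ioi 0, ?_, ?_⟩
  · have h := Cardinal.mk_image_eq_of_injOn_lift (fun x : ℝ => (P x).range) (Set.Ioi 0) hinj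
    rw [Cardinal.mk_Ioi_real, Cardinal.lift_continuum, Cardinal.lift_uzero] at h
    exact h
  · rintro _ ⟨x, hx, rfl⟩
    exact (hP x hx).2.2.2
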